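/- Let $I=\{i_-,i_+ : i\in\mathbb{Z}\}$ be marked points on the two boundary lines of a horizontal strip ($i_-$ ordered from left to right on the lower line, $i_+$ from left to right on the upper line), with the cyclic order given by running along the lower line from left to right and then along the upper line from right to left. Let $\mathcal{A}_\infty$ be the $\mathbb{Q}$-algebra generated by $x_{ab}^{\pm1}$, $a\neq b$ in $I$, subject to the triangle relations $x_{ab}x_{cb}^{-1}x_{ca}=x_{ac}x_{bc}^{-1}x_{ba}$ for distinct $a,b,c\in I$ and the exchange relations $x_{bd}=x_{bc}x_{ac}^{-1}x_{ad}+x_{ba}x_{ca}^{-1}x_{cd}$ for all cyclic $(a,b,c,d)$ in $I$. For $i,j\in\mathbb{Z}$ put $$U_{ij}=x_{i_-,j_+},\quad V_{ij}=x_{i_+,j_-},\quad A_j=x_{(j+1)_+,j_+}^{-1},\quad \overline A_j=x_{j_+,(j+1)_+}^{-1},\quad B_j=x_{(j+1)_-,j_-}^{-1},\quad \overline B_j=x_{j_-,(j+1)_-}^{-1}.$$ Let $\mathbb{T}_\infty$ be the triangle group of the triangulation of the strip by the segments $i_-i_+$, the diagonals $i_-(i+1)_+$ and the boundary segments: it is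 generated by one element $t_{ab}$ for each directed edge of the triangulation, subject to $t_{i_-,i_+}t_{(i+1)_+,i_+}^{-1}t_{(i+1)_+,i_-}=t_{i_-,(i+1)_+}t_{i_+,(i+1)_+}^{-1}t_{i_+,i_-}$ and $t_{(i+1)_+,i_-}t_{(i+1)_-,i_-}^{-1}t_{(i+1)_-,(i+1)_+}=t_{(i+1)_+,(i+1)_-}t_{i_-,(i+1)_-}^{-1}t_{i_-,(i+1)_+}$ for all $i\in\mathbb{Z}$. **Theorem.** The group $\mathbb{T}_\infty$ is free, freely generated by the elements corresponding to $A_i,\overline A_i,B_i,U_{ii},V_{ii},U_{i,i+1}$, $i\in\mathbb{Z}$, and $t_{ab}\mapsto x_{ab}$ defines an injective homomorphism $\mathbb{Q}\mathbb{T}_\infty\to\mathcal{A}_\infty$, by which $\mathbb{Q}\mathbb{T}_\infty$ is regarded as a subalgebra of $\mathcal{A}_\infty$. All $U_{ij}$ and $V_{ij}$ belong to $\mathbb{Z}\mathbb{T}_\infty$; each of them is a (nonempty finite) sum of elements of $\mathbb{T}_\infty$. They satisfy, for all $i,j\in\mathbb{Z}$, $$U_{i+1,j}A_jV_{j+1,i}=B_i^{-1}+U_{i+1,j+1}\overline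 A_jV_{ji},\qquad V_{i+1,j}B_jU_{j+1,i}=A_i^{-1}+V_{i+1,j+1}\overline B_jU_{ji},$$ $$U_{ij}A_jV_{j+1,i}=U_{i,j+1}\overline A_jV_{ji},\qquad V_{ij}B_jU_{j+1,i}=V_{i,j+1}\overline B_jU_{ji},$$ and they are the only families in $\mathbb{Q}\mathbb{T}_\infty$ that satisfy these equations and have the given values $U_{ii},V_{ii},U_{i,i+1}$, $i\in\mathbb{Z}$. Furthermore, let $\mathrm{Frac}$ be the universal skew field of fractions of $\mathbb{Q}\mathbb{T}_\infty$, that is, its universal localization at all full square matrices. Then the $U_{ij}$ and $V_{ij}$ are invertible in $\mathrm{Frac}$, and the elements $$H^+_{ij}=U_{ji}^{-1}\big(U_{j,i-1}A_{i-1}+U_{j,i+1}\overline A_i\big),\qquad H^-_{ij}=V_{ji}^{-1}\big(V_{j,i-1}B_{i-1}+V_{j,i+1}\overline B_i\big)$$ of $\mathrm{Frac}$ do not depend on $j$ and belong to $\mathbb{Z}\mathbb{T}_\infty$: there are $H_i^\pm\in\mathbb{Z}\mathbb{T}_\infty$ with $H^\pm_{ij}=H^\pm_i$ for all $i,j$,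 and already in $\mathbb{Q}\mathbb{T}_\infty$ one has $U_{ji}H_i^+=U_{j,i-1}A_{i-1}+U_{j,i+1}\overline A_i$ and $V_{ji}H_i^-=V_{j,i-1}B_{i-1}+V_{j,i+1}\overline B_i$. -/

import Mathlib

/-!
Noncommutative infinite strip: marked points, the algebra of the strip, the triangle group of the
zigzag triangulation, the skew field of fractions as a universal localization, and the recursions.
-/

namespace NCStrip

/-! ### Marked points and directed arcs of the strip -/

/-- The marked points `i₋` (`lower i`) and `i₊` (`upper i`) on the two boundary lines. -/
inductive Pt : Type
  | lower (i : ℤ) : Pt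
  | upper (i : ℤ) : Pt

/-- The boundary of the strip, traversed once: the lower line from left to right, then the upper
line from right to left. On the vertices of every polygon `[a + 1, a + n]₋ ∪ [b + 1, b + n]₊` this
is the order `1 < 2 < ⋯ < 2 n` of the vertices of the polygon. -/
def Pt.Before : Pt → Pt → Prop
  | .lower i, .lower j => i < j
  | .lower _, .upper _ => True
  | .upper _, .lower _ => False
  | .upper i, .upper j => j < i

/-- `(a, b, c, d)` is strictly increasing for the order `Pt.Before`. -/
def Increasing (a b c d : Pt) : Prop :=
  a.Before b ∧ b.Before c ∧ c.Before d

/-- `(a, b, c, d)` is cyclic: some cyclic rotation of it is strictly increasing. -/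
def Cyclic (a b c d : Pt) : Prop :=
  Increasing a b c d ∨ Increasing b c d a ∨ Increasing c d a b ∨ Increasing d a b c

/-- Directed arcs of the strip: ordered pairs of distinct marked points. -/
structure Arc : Type where
  src : Pt
  tgt : Pt
  ne : src ≠ tgt

/-! ### The algebra of the strip -/

/-- Generators of the algebra: `x_γ` and `x_γ⁻¹` for every directed arc `γ`. -/
inductive AlgGen : Type
  | edge (γ : Arc) : AlgGen
  | edgeInv (γ : Arc) : AlgGen

/-- The free generator that becomes `x_{ab}`. -/
noncomputable def fx (a b : Pt) (h : a ≠ b) : FreeAlgebra ℚ AlgGen :=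
  FreeAlgebra.ι ℚ (AlgGen.edge ⟨a, b, h⟩)

/-- The free generator that becomes `x_{ab}⁻¹`. -/
noncomputable def fxInv (a b : Pt) (h : a ≠ b) : FreeAlgebra ℚ AlgGen :=
  FreeAlgebra.ι ℚ (AlgGen.edgeInv ⟨a, b, h⟩)

/-- Defining relations: inverses, triangle relations for all triples of distinct marked points, and
exchange relations for all cyclic quadruples. -/
inductive AlgRel : FreeAlgebra ℚ AlgGen → FreeAlgebra ℚ AlgGen → Prop
  | mul_inv (a b : Pt) (h : a ≠ b) : AlgRel (fx a b h * fxInv a b h) 1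
  | inv_mul (a b : Pt) (h : a ≠ b) : AlgRel (fxInv a b h * fx a b h) 1
  | triangle (a b c : Pt) (hab : a ≠ b) (hbc : b ≠ c) (hac : a ≠ c) :
      AlgRel (fx a b hab * fxInv c b hbc.symm * fx c a hac.symm)
        (fx a c hac * fxInv b c hbc * fx b a hab.symm)
  | exchange (a b c d : Pt) (hcyc : Cyclic a b c d) (hab : a ≠ b) (hac : a ≠ c) (had : a ≠ d)
      (hbc : b ≠ c) (hbd : b ≠ d) (hcd : c ≠ d) :
      AlgRel (fx b d hbd)
        (fx b c hbc * fxInv a c hac * fx a d had + fx b a hab.symm * fxInv c a hac.symm * fx c d hcd)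

/-- The `ℚ`-algebra of the strip. Every relation involves finitely many marked points and every
finite set of marked points lies in one of the polygons that exhaust the strip, so this is the
direct limit of the algebras of these polygons. -/
abbrev StripAlg : Type := RingQuot AlgRel

/-- The element `x_{ab}` of the algebra of the strip. -/
noncomputable def edge (a b : Pt) (h : a ≠ b) : StripAlg :=
  RingQuot.mkAlgHom ℚ AlgRel (fx a b h)

/-- The element `x_{ab}⁻¹` of the algebra of the strip. -/
noncomputable def edgeInv (a b : Pt) (h : a ≠ b) : StripAlg :=
  RingQuot.mkAlgHom ℚ AlgRel (fxInv a b h)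

theorem edge_mul_edgeInv (a b : Pt) (h : a ≠ b) : edge a b h * edgeInv a b h = 1 := by
  have := RingQuot.mkAlgHom_rel ℚ (AlgRel.mul_inv a b h)
  simpa [edge, edgeInv] using this

theorem edgeInv_mul_edge (a b : Pt) (h : a ≠ b) : edgeInv a b h * edge a b h = 1 := by
  have := RingQuot.mkAlgHom_rel ℚ (AlgRel.inv_mul a b h)
  simpa [edge, edgeInv] using this

/-- `x_{ab}` as a unit. -/
noncomputable def edgeUnit (a b : Pt) (h : a ≠ b) : StripAlgˣ :=
  ⟨edge a b h, edgeInv a b h, edge_mul_edgeInv a b h, edgeInv_mul_edge a b h⟩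

theorem edgeUnit_triangle (a b c : Pt) (hab : a ≠ b) (hbc : b ≠ c) (hac : a ≠ c) :
    edgeUnit a b hab * (edgeUnit c b hbc.symm)⁻¹ * edgeUnit c a hac.symm =
      edgeUnit a c hac * (edgeUnit b c hbc)⁻¹ * edgeUnit b a hab.symm := by
  apply Units.ext
  have := RingQuot.mkAlgHom_rel ℚ (AlgRel.triangle a b c hab hbc hac)
  simpa [edge, edgeInv, edgeUnit] using this

theorem lower_ne_upper (i j : ℤ) : Pt.lower i ≠ Pt.upper j := fun h => Pt.noConfusion h

theorem upper_ne_lower (i j : ℤ) : Pt.upper i ≠ Pt.lower j := fun h => Pt.noConfusion h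

theorem lower_ne_succ (i : ℤ) : Pt.lower i ≠ Pt.lower (i + 1) := by
  intro h; injection h with h; omega

theorem upper_ne_succ (i : ℤ) : Pt.upper i ≠ Pt.upper (i + 1) := by
  intro h; injection h with h; omega

/-! ### The triangle group of the zigzag triangulation -/

/-- The directed arcs of the triangulation: the boundary segments `i_± ⇄ (i+1)_±`, the segments
`i₋ ⇄ i₊` and the diagonals `i₋ ⇄ (i+1)₊`. The two directions are distinguished by `'`. -/
inductive TriArc : Type
  | dLower (i : ℤ) : TriArc
  | dLower' (i : ℤ) : TriArc
  | dUpper (i : ℤ) : TriArc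
  | dUpper' (i : ℤ) : TriArc
  | x (i : ℤ) : TriArc
  | x' (i : ℤ) : TriArc
  | y (i : ℤ) : TriArc
  | y' (i : ℤ) : TriArc

/-- The element `x_γ` (as a unit) that belongs to a directed arc `γ` of the triangulation. -/
noncomputable def TriArc.unit : TriArc → StripAlgˣ
  | .dLower i => edgeUnit (.lower i) (.lower (i + 1)) (lower_ne_succ i)
  | .dLower' i => edgeUnit (.lower (i + 1)) (.lower i) (lower_ne_succ i).symm
  | .dUpper i => edgeUnit (.upper i) (.upper (i + 1)) (upper_ne_succ i)
  | .dUpper' i => edgeUnit (.upper (i + 1)) (.upper i) (upper_ne_succ i).symm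
  | .x i => edgeUnit (.lower i) (.upper i) (lower_ne_upper i i)
  | .x' i => edgeUnit (.upper i) (.lower i) (upper_ne_lower i i)
  | .y i => edgeUnit (.lower i) (.upper (i + 1)) (lower_ne_upper i (i + 1))
  | .y' i => edgeUnit (.upper (i + 1)) (.lower i) (upper_ne_lower (i + 1) i)

open TriArc in
/-- The triangle relation of the triangle `(i₋, i₊, (i+1)₊)`. -/
def upperRel (i : ℤ) : FreeGroup TriArc :=
  (FreeGroup.of (x i) * (FreeGroup.of (dUpper' i))⁻¹ * FreeGroup.of (y' i)) *
    (FreeGroup.of (y i) * (FreeGroup.of (dUpper i))⁻¹ * FreeGroup.of (x' i))⁻¹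

open TriArc in
/-- The triangle relation of the triangle `((i+1)₊, i₋, (i+1)₋)`. -/
def lowerRel (i : ℤ) : FreeGroup TriArc :=
  (FreeGroup.of (y' i) * (FreeGroup.of (dLower' i))⁻¹ * FreeGroup.of (x (i + 1))) *
    (FreeGroup.of (x' (i + 1)) * (FreeGroup.of (dLower i))⁻¹ * FreeGroup.of (y i))⁻¹

/-- The triangle group of the triangulation. -/
abbrev T : Type := PresentedGroup (Set.range upperRel ∪ Set.range lowerRel)

/-- The generator of the triangle group that belongs to a directed arc of the triangulation. -/
def t (γ : TriArc) : T := PresentedGroup.of γ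

theorem unit_rels : ∀ r ∈ Set.range upperRel ∪ Set.range lowerRel,
    FreeGroup.lift TriArc.unit r = 1 := by
  rintro r (⟨i, rfl⟩ | ⟨i, rfl⟩)
  · rw [upperRel, map_mul, map_inv, mul_inv_eq_one]
    simpa [TriArc.unit] using edgeUnit_triangle (.lower i) (.upper i) (.upper (i + 1))
      (lower_ne_upper _ _) (upper_ne_succ _) (lower_ne_upper _ _)
  · rw [lowerRel, map_mul, map_inv, mul_inv_eq_one]
    simpa [TriArc.unit] using edgeUnit_triangle (.upper (i + 1)) (.lower i) (.lower (i + 1))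
      (upper_ne_lower _ _) (lower_ne_succ _) (upper_ne_lower _ _)

/-- The group homomorphism `t_γ ↦ x_γ`. -/
noncomputable def toUnits : T →* StripAlgˣ := PresentedGroup.toGroup unit_rels

/-- The rational group algebra of the triangle group. -/
abbrev QT : Type := MonoidAlgebra ℚ T

/-- A group element as an element of the group algebra. -/
noncomputable def el (g : T) : QT := MonoidAlgebra.of ℚ T g

/-- The integral group ring, as a subring of the rational group algebra. -/
noncomputable def ZT : Subring QT := (MonoidAlgebra.mapRingHom T (Int.castRingHom ℚ)).range

/-- The canonical algebra homomorphism from the group algebra to the algebra of the strip,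
`t_γ ↦ x_γ`. -/
noncomputable def toStrip : QT →ₐ[ℚ] StripAlg :=
  MonoidAlgebra.lift ℚ StripAlg T ((Units.coeHom StripAlg).comp toUnits)

/-- `u` is a (nonempty, finite) sum of group elements. -/
def IsSumOfElements (u : QT) : Prop := ∃ s : Multiset T, s ≠ 0 ∧ u = (s.map el).sum

/-! ### The coefficients and the recursion -/

/-- `A_i = x_{(i+1)₊, i₊}⁻¹`. -/
def A (i : ℤ) : T := (t (.dUpper' i))⁻¹

/-- `Ā_i = x_{i₊, (i+1)₊}⁻¹`. -/
def A' (i : ℤ) : T := (t (.dUpper i))⁻¹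

/-- `B_i = x_{(i+1)₋, i₋}⁻¹`. -/
def B (i : ℤ) : T := (t (.dLower' i))⁻¹

/-- `B̄_i = x_{i₋, (i+1)₋}⁻¹`. -/
def B' (i : ℤ) : T := (t (.dLower i))⁻¹

/-- Index set of the free generators `A_i, Ā_i, B_i, U_{i,i}, V_{i,i}, U_{i,i+1}`. -/
inductive FreeGen : Type
  | a (i : ℤ) : FreeGen
  | a' (i : ℤ) : FreeGen
  | b (i : ℤ) : FreeGen
  | u (i : ℤ) : FreeGen
  | v (i : ℤ) : FreeGen
  | w (i : ℤ) : FreeGen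

/-- The corresponding elements of the triangle group. -/
def FreeGen.val : FreeGen → T
  | .a i => A i
  | .a' i => A' i
  | .b i => B i
  | .u i => t (.x i)
  | .v i => t (.x' i)
  | .w i => t (.y i)

/-- The recursion. -/
structure IsSolution (U V : ℤ → ℤ → QT) : Prop where
  exchange_U : ∀ i j : ℤ, U (i + 1) j * el (A j) * V (j + 1) i =
    el (B i)⁻¹ + U (i + 1) (j + 1) * el (A' j) * V j i
  exchange_V : ∀ i j : ℤ, V (i + 1) j * el (B j) * U (j + 1) i =
    el (A i)⁻¹ + V (i + 1) (j + 1) * el (B' j) * U j i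
  triangle_U : ∀ i j : ℤ, U i j * el (A j) * V (j + 1) i = U i (j + 1) * el (A' j) * V j i
  triangle_V : ∀ i j : ℤ, V i j * el (B j) * U (j + 1) i = V i (j + 1) * el (B' j) * U j i

/-- The initial data: `U_{i,i}`, `V_{i,i}` and `U_{i,i+1}` are the corresponding generators of the
triangle group. -/
structure HasInitialData (U V : ℤ → ℤ → QT) : Prop where
  U_diag : ∀ i : ℤ, U i i = el (t (.x i))
  V_diag : ∀ i : ℤ, V i i = el (t (.x' i))
  U_succ : ∀ i : ℤ, U i (i + 1) = el (t (.y i))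

/-! ### The universal field of fractions -/

/-- A square matrix is full if it is not a product of an `n × p` and a `p × n` matrix with
`p < n`. -/
def IsFull {R : Type*} [Ring R] {n : ℕ} (M : Matrix (Fin n) (Fin n) R) : Prop :=
  ∀ (p : ℕ) (P : Matrix (Fin n) (Fin p) R) (Q : Matrix (Fin p) (Fin n) R), M = P * Q → n ≤ p

/-- Full square matrices of all sizes. -/
structure FullMatrix (R : Type*) [Ring R] where
  size : ℕ
  mat : Matrix (Fin size) (Fin size) R
  full : IsFull mat

/-- Generators of the universal localization: the elements of `R` and the entries of the inverses
of the full matrices. -/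
inductive FracGen (R : Type*) [Ring R] : Type _
  | of (r : R) : FracGen R
  | inv (M : FullMatrix R) (k l : Fin M.size) : FracGen R

/-- Image of an element of `R` in the free ring. -/
noncomputable def fracOf {R : Type*} [Ring R] (r : R) : FreeAlgebra ℤ (FracGen R) :=
  FreeAlgebra.ι ℤ (FracGen.of r)

/-- Image of a full matrix in the matrices over the free ring. -/
noncomputable def fracMat {R : Type*} [Ring R] (M : FullMatrix R) :
    Matrix (Fin M.size) (Fin M.size) (FreeAlgebra ℤ (FracGen R)) :=
  Matrix.of fun k l => fracOf (M.mat k l)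

/-- The formal inverse of a full matrix. -/
noncomputable def fracInv {R : Type*} [Ring R] (M : FullMatrix R) :
    Matrix (Fin M.size) (Fin M.size) (FreeAlgebra ℤ (FracGen R)) :=
  Matrix.of fun k l => FreeAlgebra.ι ℤ (FracGen.inv M k l)

/-- Relations of the universal localization of `R` at its full matrices. -/
inductive FracRel (R : Type*) [Ring R] :
    FreeAlgebra ℤ (FracGen R) → FreeAlgebra ℤ (FracGen R) → Prop
  | one : FracRel R (fracOf 1) 1
  | add (r s : R) : FracRel R (fracOf (r + s)) (fracOf r + fracOf s)
  | mul (r s : R) : FracRel R (fracOf (r * s)) (fracOf r * fracOf s)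
  | mul_inv (M : FullMatrix R) (k l : Fin M.size) :
      FracRel R ((fracMat M * fracInv M) k l)
        ((1 : Matrix (Fin M.size) (Fin M.size) (FreeAlgebra ℤ (FracGen R))) k l)
  | inv_mul (M : FullMatrix R) (k l : Fin M.size) :
      FracRel R ((fracInv M * fracMat M) k l)
        ((1 : Matrix (Fin M.size) (Fin M.size) (FreeAlgebra ℤ (FracGen R))) k l)

/-- `Frac R`: the universal localization of `R` at the set of all full matrices. For a semifir
(such as the group algebra of a free group over a field) it is the universal skew field of
fractions of `R`. -/
abbrev Frac (R : Type*) [Ring R] : Type _ := RingQuot (FracRel R)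

/-- The canonical ring homomorphism from `R` to `Frac R`. -/
noncomputable def toFrac (R : Type*) [Ring R] : R →+* Frac R where
  toFun r := RingQuot.mkRingHom (FracRel R) (fracOf r)
  map_one' := by
    rw [RingQuot.mkRingHom_rel FracRel.one, map_one]
  map_mul' r s := by
    rw [RingQuot.mkRingHom_rel (FracRel.mul r s), map_mul]
  map_zero' := by
    have h := RingQuot.mkRingHom_rel (FracRel.add (0 : R) 0)
    rw [map_add, add_zero] at h
    exact left_eq_add.mp h
  map_add' r s := by
    rw [RingQuot.mkRingHom_rel (FracRel.add r s), map_add]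

/-! ### The conserved quantities -/

/-- `H⁺_{ij} = U_{ji}⁻¹ (U_{j,i-1} A_{i-1} + U_{j,i+1} Ā_i)` in `Frac`. -/
noncomputable def HPlus (U : ℤ → ℤ → QT) (i j : ℤ) : Frac QT :=
  Ring.inverse (toFrac QT (U j i)) *
    toFrac QT (U j (i - 1) * el (A (i - 1)) + U j (i + 1) * el (A' i))

/-- `H⁻_{ij} = V_{ji}⁻¹ (V_{j,i-1} B_{i-1} + V_{j,i+1} B̄_i)` in `Frac`. -/
noncomputable def HMinus (V : ℤ → ℤ → QT) (i j : ℤ) : Frac QT :=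
  Ring.inverse (toFrac QT (V j i)) *
    toFrac QT (V j (i - 1) * el (B (i - 1)) + V j (i + 1) * el (B' i))

end NCStrip

namespace NCStrip

/-! ### The triangle group is free -/

/-! Freeness is elimination of generators. The relation of an upper triangle can be solved for `t
(.y' i)`, and then the relation of the lower triangle for `t (.dLower i)`; the generators that
remain satisfy no relation.

Injectivity of `toStrip` rests on a representation of the algebra of the strip by Laurent series
over `QT`. Put `x_ab ↦ ± l_a (z_b - z_a) m_b`, with points `z_a` whose differences are invertible.
The weights cancel inside words `x x⁻¹ x`, so the triangle and exchange relations become identities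
between differences (`exists_realization`). If `z_a` is a monomial whose order drops along the
zigzag of marked points, the later endpoint of an arc dominates, and the weights can be tuned so
that each arc of the triangulation has its own generator as leading coefficient
(`exists_laurent_realization`). Every `g` in `T` then has leading coefficient `g`, and distinct
group elements are linearly independent, so no cancellation occurs in lowest order.

Each `x_ab` is a sum of elements of `T` by induction along the zigzag, because the exchange relation
inverts only arcs of the triangulation (`isPositive_edge_zigzag`). The recursion consists of
triangle relations and of exchange relations solved for a side, pulled back along `toStrip`;
uniqueness is propagation in `j - i`. Finally `H_i^±` is the noncommutative angle `x_ca⁻¹ x_cd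
x_ad⁻¹` at a boundary point `a` between its neighbours `c` and `d`. Additivity of angles
(`edge_mul_angle`), seen from any point of the opposite line, gives the formula, and the angle does
not involve that point. -/

/-- The word in the free generators that represents a generator of the triangle group. -/
def TriArc.word : TriArc → FreeGroup FreeGen
  | .dUpper' i => (FreeGroup.of (.a i))⁻¹
  | .dUpper i => (FreeGroup.of (.a' i))⁻¹
  | .dLower' i => (FreeGroup.of (.b i))⁻¹
  | .x i => FreeGroup.of (.u i)
  | .x' i => FreeGroup.of (.v i)
  | .y i => FreeGroup.of (.w i)
  -- The last two words solve the upper relation for `y' i`, and the lower relation for `dLower i`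
  -- with that word substituted.
  | .y' i => (FreeGroup.of (.a i))⁻¹ * (FreeGroup.of (.u i))⁻¹ * FreeGroup.of (.w i) *
      FreeGroup.of (.a' i) * FreeGroup.of (.v i)
  | .dLower i => FreeGroup.of (.w i) * ((FreeGroup.of (.v (i + 1)))⁻¹ *
      ((FreeGroup.of (.a i))⁻¹ * (FreeGroup.of (.u i))⁻¹ * FreeGroup.of (.w i) *
      FreeGroup.of (.a' i) * FreeGroup.of (.v i)) * FreeGroup.of (.b i) *
      FreeGroup.of (.u (i + 1)))⁻¹

theorem word_rels : ∀ r ∈ Set.range upperRel ∪ Set.range lowerRel,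
    FreeGroup.lift TriArc.word r = 1 := by
  rintro r (⟨i, rfl⟩ | ⟨i, rfl⟩)
  · simp only [upperRel, map_mul, map_inv, FreeGroup.lift_apply_of, TriArc.word]
    group
  · simp only [lowerRel, map_mul, map_inv, FreeGroup.lift_apply_of, TriArc.word]
    group

/-- The homomorphism that writes an element of the triangle group in the free generators. -/
def toFree : T →* FreeGroup FreeGen := PresentedGroup.toGroup word_rels

theorem toFree_t (γ : TriArc) : toFree (t γ) = γ.word := PresentedGroup.toGroup.of word_rels

theorem t_upperRel (i : ℤ) :
    t (.x i) * (t (.dUpper' i))⁻¹ * t (.y' i) = t (.y i) * (t (.dUpper i))⁻¹ * t (.x' i) :=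
  mul_inv_eq_one.mp (PresentedGroup.one_of_mem (rels := Set.range upperRel ∪ Set.range lowerRel)
    (Or.inl ⟨i, rfl⟩))

theorem t_lowerRel (i : ℤ) :
    t (.y' i) * (t (.dLower' i))⁻¹ * t (.x (i + 1)) =
      t (.x' (i + 1)) * (t (.dLower i))⁻¹ * t (.y i) :=
  mul_inv_eq_one.mp (PresentedGroup.one_of_mem (rels := Set.range upperRel ∪ Set.range lowerRel)
    (Or.inr ⟨i, rfl⟩))

theorem t_y' (i : ℤ) :
    t (.y' i) = t (.dUpper' i) * (t (.x i))⁻¹ * t (.y i) * (t (.dUpper i))⁻¹ * t (.x' i) := by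
  have h := t_upperRel i
  rw [mul_assoc, mul_assoc, ← eq_inv_mul_iff_mul_eq, ← eq_inv_mul_iff_mul_eq] at h
  rw [h]
  group

theorem t_dLower (i : ℤ) :
    t (.dLower i) = t (.y i) *
      ((t (.x' (i + 1)))⁻¹ * t (.y' i) * (t (.dLower' i))⁻¹ * t (.x (i + 1)))⁻¹ := by
  have h : (t (.x' (i + 1)))⁻¹ * t (.y' i) * (t (.dLower' i))⁻¹ * t (.x (i + 1)) =
      (t (.dLower i))⁻¹ * t (.y i) := by
    simp only [mul_assoc, inv_mul_eq_iff_eq_mul]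
    simpa only [mul_assoc] using t_lowerRel i
  rw [h]
  group

theorem lift_val_word (γ : TriArc) : FreeGroup.lift FreeGen.val γ.word = t γ := by
  cases γ with
  | y' i => rw [t_y']; simp [TriArc.word, FreeGen.val, A, A']
  | dLower i => rw [t_dLower, t_y']; simp [TriArc.word, FreeGen.val, A, A', B]
  | _ => simp [TriArc.word, FreeGen.val, A, A', B]

theorem lift_val_bijective :
    Function.Bijective (FreeGroup.lift FreeGen.val : FreeGroup FreeGen →* T) := by
  refine Function.bijective_iff_has_inverse.mpr ⟨toFree, fun w => ?_, fun g => ?_⟩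
  · refine DFunLike.congr_fun (f := toFree.comp (FreeGroup.lift FreeGen.val))
      (g := MonoidHom.id _) (FreeGroup.ext_hom _ _ fun s => ?_) w
    cases s <;> simp [FreeGen.val, A, A', B, toFree_t, TriArc.word]
  · refine DFunLike.congr_fun (f := (FreeGroup.lift FreeGen.val).comp toFree)
      (g := MonoidHom.id _) (PresentedGroup.ext fun γ => ?_) g
    exact (congrArg _ (toFree_t γ)).trans (lift_val_word γ)

/-! ### Identities in the algebra of the strip -/

section Identities
variable {a b c d : Pt}

theorem edge_triangle (hab : a ≠ b) (hbc : b ≠ c) (hac : a ≠ c) :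
    edge a b hab * edgeInv c b hbc.symm * edge c a hac.symm =
      edge a c hac * edgeInv b c hbc * edge b a hab.symm := by
  simpa [edge, edgeInv] using RingQuot.mkAlgHom_rel ℚ (AlgRel.triangle a b c hab hbc hac)

/-- The exchange relation does not depend on the orientation of the quadrilateral. -/
theorem edge_exchange (hcyc : Cyclic a b c d ∨ Cyclic c b a d) (hab : a ≠ b) (hac : a ≠ c)
    (had : a ≠ d) (hbc : b ≠ c) (hbd : b ≠ d) (hcd : c ≠ d) :
    edge b d hbd = edge b c hbc * edgeInv a c hac * edge a d had +
      edge b a hab.symm * edgeInv c a hac.symm * edge c d hcd := by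
  rcases hcyc with h | h
  · simpa [edge, edgeInv] using
      RingQuot.mkAlgHom_rel ℚ (AlgRel.exchange a b c d h hab hac had hbc hbd hcd)
  · rw [add_comm]
    simpa [edge, edgeInv] using RingQuot.mkAlgHom_rel ℚ
      (AlgRel.exchange c b a d h hbc.symm hac.symm hcd hab.symm hbd had)

/-- The exchange relation solved for a side of the quadrilateral. -/
theorem edge_exchange_side (hcyc : Cyclic a b c d ∨ Cyclic c b a d) (hab : a ≠ b) (hac : a ≠ c)
    (had : a ≠ d) (hbc : b ≠ c) (hbd : b ≠ d) (hcd : c ≠ d) :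
    edge b d hbd * edgeInv c d hcd * edge c a hac.symm =
      edge b a hab.symm + edge b c hbc * edgeInv d c hcd.symm * edge d a had.symm := by
  -- The triangle relation for `a, d, c` reverses the closed path at the end, after which `x_ac⁻¹
  -- x_ac` cancels.
  have h1 : edge b c hbc * edgeInv a c hac * edge a d had * edgeInv c d hcd * edge c a hac.symm =
      edge b c hbc * edgeInv d c hcd.symm * edge d a had.symm := by
    calc _ = edge b c hbc * edgeInv a c hac *
          (edge a d had * edgeInv c d hcd * edge c a hac.symm) := by simp only [mul_assoc]
      _ = edge b c hbc * (edgeInv a c hac * edge a c hac) *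
          (edgeInv d c hcd.symm * edge d a had.symm) := by
        rw [edge_triangle had hcd.symm hac]; simp only [mul_assoc]
      _ = _ := by rw [edgeInv_mul_edge, mul_one, mul_assoc]
  have h2 : edge b a hab.symm * edgeInv c a hac.symm * edge c d hcd * edgeInv c d hcd *
      edge c a hac.symm = edge b a hab.symm := by
    rw [mul_assoc _ (edge c d hcd), edge_mul_edgeInv, mul_one, mul_assoc, edgeInv_mul_edge, mul_one]
  rw [edge_exchange hcyc hab hac had hbc hbd hcd, add_mul, add_mul, h1, h2, add_comm]

/-- The angle at `a` between `c` and `d` is the sum of the angles between `c`, `b` and between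
`b`, `d`. -/
theorem edge_mul_angle (hcyc : Cyclic a c b d ∨ Cyclic b c a d) (hab : a ≠ b) (hac : a ≠ c)
    (had : a ≠ d) (hbc : b ≠ c) (hbd : b ≠ d) (hcd : c ≠ d) :
    edge b a hab.symm * (edgeInv c a hac.symm * edge c d hcd * edgeInv a d had) =
      edge b c hbc * edgeInv a c hac + edge b d hbd * edgeInv a d had := by
  have h1 : edge b a hab.symm * edgeInv c a hac.symm * edge c b hbc.symm * edgeInv a b hab =
      edge b c hbc * edgeInv a c hac := by
    rw [edge_triangle hab.symm hac hbc, mul_assoc, edge_mul_edgeInv, mul_one]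
  -- Cut the angle along the diagonal `ab`: the exchange relation expands `x_cd`.
  calc _ = edge b a hab.symm * edgeInv c a hac.symm * edge c b hbc.symm * edgeInv a b hab *
        (edge a d had * edgeInv a d had) + edge b a hab.symm *
        (edgeInv c a hac.symm * edge c a hac.symm) *
        edgeInv b a hab.symm * edge b d hbd * edgeInv a d had := by
        rw [edge_exchange hcyc hac hab had hbc.symm hcd hbd]
        simp only [mul_add, add_mul, mul_assoc]
    _ = _ := by
        rw [h1, edge_mul_edgeInv, edgeInv_mul_edge, mul_one, mul_one, edge_mul_edgeInv, one_mul]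

end Identities

/-! ### The zigzag enumeration of the marked points -/

/-- The marked points in the order of the zigzag `⋯, 0₊, 0₋, 1₊, 1₋, ⋯`. -/
def zigzag (k : ℤ) : Pt := if k % 2 = 0 then .upper (k / 2) else .lower (k / 2)

theorem zigzag_upper (i : ℤ) : zigzag (2 * i) = .upper i := by simp [zigzag]

theorem zigzag_lower (i : ℤ) : zigzag (2 * i + 1) = .lower i := by
  rw [zigzag, if_neg (by omega)]; congr 1; omega

theorem zigzag_injective : Function.Injective zigzag := by
  intro k l h
  unfold zigzag at h
  split_ifs at h <;> simp at h <;> omega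

theorem zigzag_surjective : Function.Surjective zigzag
  | .upper i => ⟨2 * i, zigzag_upper i⟩
  | .lower i => ⟨2 * i + 1, zigzag_lower i⟩

theorem zigzag_add_one_upper (i : ℤ) : zigzag (2 * i + 1 + 1) = .upper (i + 1) := by
  rw [← zigzag_upper]; congr 1; ring

theorem zigzag_add_two_lower (i : ℤ) : zigzag (2 * i + 1 + 2) = .lower (i + 1) := by
  rw [← zigzag_lower]; congr 1; ring

theorem zigzag_add_two_upper (i : ℤ) : zigzag (2 * i + 2) = .upper (i + 1) := by
  rw [← zigzag_upper]; congr 1; ring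

/-- The diagonal `{l, l + 1}` of the zigzag separates the earlier points from the point `l + 2`. -/
theorem cyclic_zigzag {k l : ℤ} (h : k < l) :
    Cyclic (zigzag l) (zigzag k) (zigzag (l + 1)) (zigzag (l + 2)) ∨
      Cyclic (zigzag (l + 1)) (zigzag k) (zigzag l) (zigzag (l + 2)) := by
  rcases Int.even_or_odd' l with ⟨j, rfl | rfl⟩ <;> rcases Int.even_or_odd' k with ⟨i, rfl | rfl⟩ <;>
  simp only [zigzag_upper, zigzag_lower, zigzag_add_one_upper, zigzag_add_two_lower,
    zigzag_add_two_upper, Cyclic, Increasing, Pt.Before] <;> simp <;> omega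

/-- Neighbours in the zigzag span the interior edges of the triangulation, points two steps apart
its boundary edges. These are the base cases of the positivity induction. -/
theorem exists_triArc_succ (k : ℤ) (h : zigzag k ≠ zigzag (k + 1)) :
    (∃ γ : TriArc, γ.unit = edgeUnit (zigzag k) (zigzag (k + 1)) h) ∧
      ∃ γ : TriArc, γ.unit = edgeUnit (zigzag (k + 1)) (zigzag k) h.symm := by
  rcases Int.even_or_odd' k with ⟨i, rfl | rfl⟩
  · simp only [zigzag_upper, zigzag_lower]
    exact ⟨⟨.x' i, rfl⟩, ⟨.x i, rfl⟩⟩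
  · simp only [zigzag_add_one_upper, zigzag_lower]
    exact ⟨⟨.y i, rfl⟩, ⟨.y' i, rfl⟩⟩

theorem exists_triArc_add_two (k : ℤ) (h : zigzag k ≠ zigzag (k + 2)) :
    (∃ γ : TriArc, γ.unit = edgeUnit (zigzag k) (zigzag (k + 2)) h) ∧
      ∃ γ : TriArc, γ.unit = edgeUnit (zigzag (k + 2)) (zigzag k) h.symm := by
  rcases Int.even_or_odd' k with ⟨i, rfl | rfl⟩
  · simp only [zigzag_upper, zigzag_add_two_upper]
    exact ⟨⟨.dUpper i, rfl⟩, ⟨.dUpper' i, rfl⟩⟩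
  · simp only [zigzag_add_two_lower, zigzag_lower]
    exact ⟨⟨.dLower i, rfl⟩, ⟨.dLower' i, rfl⟩⟩

/-! ### Positive elements -/

theorem IsSumOfElements.add {u v : QT} (hu : IsSumOfElements u) (hv : IsSumOfElements v) :
    IsSumOfElements (u + v) := by
  obtain ⟨s, hs, rfl⟩ := hu
  obtain ⟨s', -, rfl⟩ := hv
  refine ⟨s + s', fun h => hs ?_, by simp⟩
  exact (add_eq_zero.mp h).1

theorem IsSumOfElements.mul {u v : QT} (hu : IsSumOfElements u) (hv : IsSumOfElements v) :
    IsSumOfElements (u * v) := by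
  obtain ⟨s, hs, rfl⟩ := hu
  obtain ⟨s', hs', rfl⟩ := hv
  refine ⟨(s ×ˢ s').map fun p => p.1 * p.2, ?_, ?_⟩
  · obtain ⟨g, hg⟩ := Multiset.exists_mem_of_ne_zero hs
    obtain ⟨g', hg'⟩ := Multiset.exists_mem_of_ne_zero hs'
    intro h
    have := Multiset.mem_map_of_mem (fun p : T × T => p.1 * p.2)
      (Multiset.mem_product.mpr ⟨hg, hg'⟩ : (g, g') ∈ s ×ˢ s')
    simp [h] at this
  · rw [Multiset.map_map]
    have : ∀ p : T × T, (el ∘ fun p : T × T => p.1 * p.2) p = el p.1 * el p.2 :=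
      fun p => map_mul _ _ _
    rw [Multiset.map_congr rfl fun p _ => this p]
    clear hs hs' this
    induction s using Multiset.induction_on with
    | empty => simp
    | cons g s ih => simp [add_mul, ← ih, Multiset.sum_map_mul_left]

theorem isSumOfElements_el (g : T) : IsSumOfElements (el g) := ⟨{g}, by simp, by simp⟩

theorem IsSumOfElements.mem_ZT {u : QT} (hu : IsSumOfElements u) : u ∈ ZT := by
  obtain ⟨s, -, rfl⟩ := hu
  refine multiset_sum_mem _ fun x hx => ?_
  obtain ⟨g, -, rfl⟩ := Multiset.mem_map.mp hx
  exact ⟨MonoidAlgebra.of ℤ T g, by simp [el]⟩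

/-- Elements of the algebra of the strip that are sums of elements of the triangle group. -/
def IsPositive (x : StripAlg) : Prop := ∃ u : QT, IsSumOfElements u ∧ toStrip u = x

theorem IsPositive.add {x y : StripAlg} (hx : IsPositive x) (hy : IsPositive y) :
    IsPositive (x + y) := by
  obtain ⟨u, hu, rfl⟩ := hx
  obtain ⟨v, hv, rfl⟩ := hy
  exact ⟨u + v, hu.add hv, map_add ..⟩

theorem IsPositive.mul {x y : StripAlg} (hx : IsPositive x) (hy : IsPositive y) :
    IsPositive (x * y) := by
  obtain ⟨u, hu, rfl⟩ := hx
  obtain ⟨v, hv, rfl⟩ := hy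
  exact ⟨u * v, hu.mul hv, map_mul ..⟩

theorem toStrip_el (g : T) : toStrip (el g) = toUnits g := by
  simp [toStrip, el]

theorem toUnits_t (γ : TriArc) : toUnits (t γ) = γ.unit := PresentedGroup.toGroup.of unit_rels

theorem isPositive_toUnits (g : T) : IsPositive (toUnits g) :=
  ⟨el g, isSumOfElements_el g, toStrip_el g⟩

theorem isPositive_edge_of_triArc {a b : Pt} {h : a ≠ b} (H : ∃ γ : TriArc, γ.unit = edgeUnit a b h) :
    IsPositive (edge a b h) ∧ IsPositive (edgeInv a b h) := by
  obtain ⟨γ, hγ⟩ := H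
  rw [← toUnits_t] at hγ
  refine ⟨?_, ?_⟩
  · have := isPositive_toUnits (t γ)
    rwa [hγ] at this
  · have := isPositive_toUnits (t γ)⁻¹
    rwa [map_inv, hγ] at this

/-- In the quadrilateral on the zigzag points `k, l, l + 1, l + 2` the exchange relation inverts
only the diagonal `{l, l + 1}`, which lies in the triangulation. The step thus needs the arcs from
`k` to `l` and to `l + 1`, hence a two-step induction. -/
theorem isPositive_edge_zigzag (k : ℤ) (n : ℕ)
    (h : zigzag k ≠ zigzag (k + 1 + n)) :
    IsPositive (edge _ _ h) ∧ IsPositive (edge _ _ h.symm) := by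
  induction n using Nat.twoStepInduction with
  | zero =>
    have H := exists_triArc_succ k (by simpa using h)
    simp only [Nat.cast_zero, add_zero]
    exact ⟨(isPositive_edge_of_triArc H.1).1, (isPositive_edge_of_triArc H.2).1⟩
  | one =>
    have e : k + 1 + (1 : ℕ) = k + 2 := by push_cast; ring
    have H := exists_triArc_add_two k (by rwa [← e])
    simp only [e]
    exact ⟨(isPositive_edge_of_triArc H.1).1, (isPositive_edge_of_triArc H.2).1⟩
  | more n ih0 ih1 =>
    obtain ⟨l, hl⟩ : ∃ l, l = k + 1 + n := ⟨_, rfl⟩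
    have e1 : k + 1 + ((n + 1 : ℕ) : ℤ) = l + 1 := by push_cast; omega
    have e2 : k + 1 + ((n + 2 : ℕ) : ℤ) = l + 2 := by push_cast; omega
    simp only [e2] at h ⊢
    simp only [e1] at ih1
    simp only [← hl] at ih0
    have hne : ∀ {p q : ℤ}, p ≠ q → zigzag p ≠ zigzag q := fun h => zigzag_injective.ne h
    have hcyc := cyclic_zigzag (k := k) (l := l) (by omega)
    obtain ⟨p0, p0'⟩ := ih0 (hne (by omega))
    obtain ⟨p1, p1'⟩ := ih1 (hne (by omega))
    have s0 := exists_triArc_succ l (hne (by omega))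
    have s1 := exists_triArc_succ (l + 1) (hne (by omega))
    have s2 := exists_triArc_add_two l (hne (by omega))
    simp only [add_assoc, one_add_one_eq_two] at s1
    have q := isPositive_edge_of_triArc s0.1
    have q' := isPositive_edge_of_triArc s0.2
    have r := isPositive_edge_of_triArc s1.1
    have r' := isPositive_edge_of_triArc s1.2
    have w := isPositive_edge_of_triArc s2.1
    have w' := isPositive_edge_of_triArc s2.2
    -- Rotation by two places interchanges `b` and `d`, so the same quadrilateral serves the
    -- reversed arc.
    have hrev : ∀ {a b c d : Pt}, Cyclic a b c d ∨ Cyclic c b a d →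
        Cyclic a d c b ∨ Cyclic c d a b := by
      intro a b c d h
      unfold Cyclic at *
      tauto
    constructor
    · rw [edge_exchange hcyc (hne (by omega)) (hne (by omega)) (hne (by omega)) (hne (by omega)) h
        (hne (by omega))]
      exact ((p1.mul q.2).mul w.1).add ((p0.mul q'.2).mul r.1)
    · rw [edge_exchange (hrev hcyc) (hne (by omega)) (hne (by omega)) (hne (by omega))
        (hne (by omega)) h.symm (hne (by omega))]
      exact ((r'.1.mul q.2).mul p0').add ((w'.1.mul q'.2).mul p1')

theorem isPositive_edge (a b : Pt) (h : a ≠ b) : IsPositive (edge a b h) := by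
  obtain ⟨k, rfl⟩ := zigzag_surjective a
  obtain ⟨l, rfl⟩ := zigzag_surjective b
  rcases lt_trichotomy k l with hkl | hkl | hkl
  · obtain ⟨n, rfl⟩ : ∃ n : ℕ, l = k + 1 + n := ⟨(l - k - 1).toNat, by omega⟩
    exact (isPositive_edge_zigzag k n h).1
  · exact absurd (congrArg zigzag hkl) h
  · obtain ⟨n, rfl⟩ : ∃ n : ℕ, k = l + 1 + n := ⟨(k - l - 1).toNat, by omega⟩
    exact (isPositive_edge_zigzag l n h.symm).2

/-! ### Realizations of the algebra of the strip by differences -/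

/-- The orientation sign of a directed arc, for the cyclic order cut open at the right end. -/
def sgn : Pt → Pt → ℤ
  | .upper _, .lower _ => 1
  | .lower _, .upper _ => -1
  | .lower i, .lower j => if i < j then 1 else -1
  | .upper i, .upper j => if j < i then 1 else -1

theorem sgn_mul_self (a b : Pt) : sgn a b * sgn a b = 1 := by
  cases a <;> cases b <;> simp only [sgn] <;> (try split_ifs) <;> rfl

theorem sgn_swap {a b : Pt} (h : a ≠ b) : sgn b a = -sgn a b := by
  rcases a with i | i <;> rcases b with j | j <;> simp only [sgn]
  · have : i ≠ j := fun e => h (congrArg _ e)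
    split_ifs <;> omega
  · rfl
  · have : i ≠ j := fun e => h (congrArg _ e)
    split_ifs <;> omega

/-- All three monomials of the exchange relation carry the same sign, which leaves an identity of
unsigned differences. -/
theorem sgn_exchange {a b c d : Pt} (h : Cyclic a b c d) :
    sgn b c * sgn a c * sgn a d = sgn b d ∧ sgn b a * sgn c a * sgn c d = sgn b d := by
  rcases a with a | a <;> rcases b with b | b <;> rcases c with c | c <;> rcases d with d | d <;>
  simp [Cyclic, Increasing, Pt.Before] at h <;> simp only [sgn] <;>
  constructor <;> (try split_ifs) <;> omega

section Realization
variable {D : Type*} [Ring D]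

/-- Substituting `r = -p - q` turns both sides into `-p q' p - p`. -/
theorem diff_triangle {p q r q' : D} (h : p + q + r = 0) (h1 : q * q' = 1) (h2 : q' * q = 1) :
    p * q' * r = r * q' * p := by
  obtain rfl : r = -p - q := by rw [← sub_eq_zero, ← h]; abel
  simp only [mul_sub, sub_mul, mul_neg, neg_mul, mul_assoc, h2]
  rw [← mul_assoc q q' p, h1]
  simp

/-- With `p = z_b - z_a`, `q = z_c - z_a`, `r = z_d - z_c` this is the exchange relation for
differences; the two terms `p q' r` cancel. -/
theorem diff_exchange {p q r q' : D} (h1 : q * q' = 1) (h2 : q' * q = 1) :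
    (q - p) * q' * (q + r) + p * q' * r = q + r - p := by
  simp only [mul_add, sub_mul, h1, one_mul, mul_assoc, h2, mul_one]
  abel

variable [Algebra ℚ D]

/-- Points on a line over a ring with invertible differences, together with weights, define a
representation of the algebra of the strip. -/
theorem exists_realization (z : Pt → D) (l m : Pt → Dˣ)
    (hz : ∀ a b : Pt, a ≠ b → IsUnit (z b - z a)) :
    ∃ Φ : StripAlg →ₐ[ℚ] D, ∀ (a b : Pt) (h : a ≠ b),
      Φ (edge a b h) = sgn a b • (l a * (z b - z a) * m b) := by
  choose! u hu using hz
  have u1 : ∀ a b, a ≠ b → (z b - z a) * ↑(u a b)⁻¹ = 1 := fun a b h => by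
    rw [← hu a b h, Units.mul_inv]
  have u2 : ∀ a b, a ≠ b → ↑(u a b)⁻¹ * (z b - z a) = 1 := fun a b h => by
    rw [← hu a b h, Units.inv_mul]
  have hswap : ∀ a b, a ≠ b → ((u b a)⁻¹ : Dˣ) = -((u a b)⁻¹ : Dˣ) := by
    intro a b h
    have : u b a = -u a b := by
      apply Units.ext
      rw [Units.val_neg, hu a b h, hu b a h.symm, neg_sub]
    rw [this, inv_neg]
  obtain ⟨f, hf1, hf2⟩ : ∃ f : FreeAlgebra ℚ AlgGen →ₐ[ℚ] D,
      (∀ a b h, f (fx a b h) = sgn a b • (l a * (z b - z a) * m b)) ∧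
      (∀ a b h, f (fxInv a b h) = sgn a b • (↑(m b)⁻¹ * ↑(u a b)⁻¹ * ↑(l a)⁻¹)) := by
    refine ⟨FreeAlgebra.lift ℚ fun
      | .edge γ => sgn γ.src γ.tgt • (l γ.src * (z γ.tgt - z γ.src) * m γ.tgt)
      | .edgeInv γ => sgn γ.src γ.tgt • (↑(m γ.tgt)⁻¹ * ↑(u γ.src γ.tgt)⁻¹ * ↑(l γ.src)⁻¹),
      fun a b h => ?_, fun a b h => ?_⟩ <;> simp [fx, fxInv]
  -- products of the form `x x⁻¹ x`
  have key : ∀ (a b c d : Pt) (hab : a ≠ b) (hcb : c ≠ b) (hcd : c ≠ d),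
      f (fx a b hab * fxInv c b hcb * fx c d hcd) = (sgn a b * sgn c b * sgn c d) •
        (l a * ((z b - z a) * ↑(u c b)⁻¹ * (z d - z c)) * m d) := by
    intro a b c d hab hcb hcd
    rw [map_mul, map_mul, hf1, hf1, hf2]
    simp only [smul_mul_assoc, mul_smul_comm, smul_smul]
    congr 1
    · ring
    · simp only [mul_assoc, Units.mul_inv_cancel_left, Units.inv_mul_cancel_left]
  refine ⟨RingQuot.liftAlgHom ℚ ⟨f, ?_⟩, fun a b h => ?_⟩
  · rintro _ _ (⟨a, b, h⟩ | ⟨a, b, h⟩ | ⟨a, b, c, hab, hbc, hac⟩ |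
      ⟨a, b, c, d, hcyc, hab, hac, had, hbc, hbd, hcd⟩)
    · rw [map_mul, hf1, hf2, map_one, smul_mul_assoc, mul_smul_comm, smul_smul, sgn_mul_self,
        one_smul, ← hu a b h]
      simp only [mul_assoc, Units.mul_inv_cancel_left, Units.mul_inv]
    · rw [map_mul, hf1, hf2, map_one, smul_mul_assoc, mul_smul_comm, smul_smul, sgn_mul_self,
        one_smul, ← hu a b h]
      simp only [mul_assoc, Units.inv_mul_cancel_left, Units.inv_mul]
    · have h := diff_triangle (p := z b - z a) (q := z c - z b) (r := z a - z c)
        (by abel) (u1 b c hbc) (u2 b c hbc)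
      rw [key, key, hswap b c hbc, sgn_swap hab, sgn_swap hac, sgn_swap hbc,
        ← neg_sub (z a) (z c), ← neg_sub (z b) (z a)]
      simp only [Units.val_neg, neg_mul, mul_neg, neg_neg, h, neg_smul, smul_neg]
      congr 1; ring_nf
    · have h := diff_exchange (p := z b - z a) (q := z c - z a) (r := z d - z c)
        (u1 a c hac) (u2 a c hac)
      rw [map_add, key, key, hf1, (sgn_exchange hcyc).1, (sgn_exchange hcyc).2, hswap a c hac,
        ← smul_add, ← add_mul, ← mul_add, ← neg_sub (z b) (z a)]
      simp only [Units.val_neg, neg_mul, mul_neg, neg_neg]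
      rw [sub_sub_sub_cancel_right, sub_add_sub_cancel', sub_sub_sub_cancel_right] at h
      rw [h]
  · rw [edge, RingQuot.liftAlgHom_mkAlgHom_apply, hf1]

end Realization

/-! ### Laurent series with an invertible leading coefficient -/

section Lead
open HahnSeries
variable {R : Type*} [Ring R]

theorem single_one_mul_comm (n : ℤ) (x : HahnSeries ℤ R) :
    single n 1 * x = x * single n 1 := by
  ext k
  rw [← sub_add_cancel k n, coeff_single_mul_add, coeff_mul_single_add, one_mul, mul_one]

/-- `x` is a Laurent series with leading coefficient `r`. -/
def HasLead (x : HahnSeries ℤ R) (r : Rˣ) : Prop :=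
  ∃ (n : ℤ) (p : (PowerSeries R)ˣ), x = single n 1 * ofPowerSeries ℤ R p ∧
    PowerSeries.constantCoeff (p : PowerSeries R) = r

theorem HasLead.isUnit {x : HahnSeries ℤ R} {r : Rˣ} (h : HasLead x r) : IsUnit x := by
  obtain ⟨n, p, rfl, -⟩ := h
  refine IsUnit.mul ⟨⟨single n 1, single (-n) 1, ?_, ?_⟩, rfl⟩ (p.isUnit.map _) <;>
    simp [single_mul_single]

theorem HasLead.mul {x y : HahnSeries ℤ R} {r s : Rˣ} (hx : HasLead x r) (hy : HasLead y s) :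
    HasLead (x * y) (r * s) := by
  obtain ⟨n, p, rfl, hp⟩ := hx
  obtain ⟨k, q, rfl, hq⟩ := hy
  refine ⟨n + k, p * q, ?_, by simp [hp, hq]⟩
  rw [Units.val_mul, map_mul, mul_assoc, ← mul_assoc _ (single k 1) _, ← single_one_mul_comm k,
    ← one_mul (1 : R), ← single_mul_single]
  simp only [mul_assoc, one_mul]

theorem HasLead.inv {x : (HahnSeries ℤ R)ˣ} {r : Rˣ} (hx : HasLead (x : HahnSeries ℤ R) r) :
    HasLead (x⁻¹ : (HahnSeries ℤ R)ˣ).val r⁻¹ := by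
  obtain ⟨n, p, hx, hp⟩ := hx
  refine ⟨-n, p⁻¹, ?_, ?_⟩
  · refine Units.inv_eq_of_mul_eq_one_right ?_
    rw [hx, mul_assoc, ← mul_assoc (ofPowerSeries ℤ R p), ← single_one_mul_comm, mul_assoc,
      ← map_mul, Units.mul_inv, ← mul_assoc, single_mul_single]
    simp
  · have : Units.map (PowerSeries.constantCoeff (R := R)).toMonoidHom p = r := Units.ext hp
    rw [← this, ← map_inv]
    rfl

theorem hasLead_C (r : Rˣ) : HasLead (C (r : R) : HahnSeries ℤ R) r :=
  ⟨0, Units.map (PowerSeries.C (R := R)).toMonoidHom r, by simp, by simp⟩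

/-- Factoring out the lower power `-l` leaves `r - X ^ (l - k) s`, whose constant coefficient is the
unit `r` because `l - k` is positive. -/
theorem hasLead_sub {k l : ℤ} (h : k < l) (r : Rˣ) (s : R) :
    HasLead (R := R) (single (-l) (r : R) - single (-k) s) r := by
  obtain ⟨n, rfl⟩ : ∃ n : ℕ, l = k + 1 + n := ⟨(l - k - 1).toNat, by omega⟩
  have hc : PowerSeries.constantCoeff
      (PowerSeries.C (r : R) - PowerSeries.X ^ (n + 1) * PowerSeries.C s) = (r : R) := by simp
  refine ⟨-(k + 1 + n), (PowerSeries.isUnit_iff_constantCoeff.mpr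
    (by rw [hc]; exact r.isUnit)).unit, ?_, hc⟩
  rw [IsUnit.unit_spec, map_sub, map_mul, ofPowerSeries_X_pow, ofPowerSeries_C, ofPowerSeries_C,
    mul_sub, C_apply, C_apply, single_mul_single, single_mul_single, single_mul_single]
  have e : -(k + 1 + n) + ((n + 1 : ℕ) : ℤ) = -k := by push_cast; ring
  simp only [one_mul, add_zero, e]

/-- In the lowest order that occurs, the coefficient of the image is a combination of distinct group
elements with nonzero scalars, so it does not vanish. -/
theorem lift_injective_of_hasLead {G : Type*} [Group G]
    (φ : G →* HahnSeries ℤ (MonoidAlgebra ℚ G))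
    (h : ∀ g, HasLead (φ g) ((MonoidAlgebra.of ℚ G).toHomUnits g)) :
    Function.Injective (MonoidAlgebra.lift ℚ (HahnSeries ℤ (MonoidAlgebra ℚ G)) G φ) := by
  rw [injective_iff_map_eq_zero]
  intro f hf
  by_contra hne
  choose n p hφ hp using h
  have hsupp : f.coeff.support.Nonempty := by
    rw [Finset.nonempty_iff_ne_empty, Ne, Finsupp.support_eq_empty]
    exact fun h0 => hne (MonoidAlgebra.coeff_injective h0)
  obtain ⟨g₀, hg₀, hmin⟩ := Finset.exists_min_image _ n hsupp
  -- Division by the lowest power turns all terms into power series; the `g₀`-component of the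
  -- constant coefficient will be `f.coeff g₀` alone.
  have hsum : ∑ g ∈ f.coeff.support, f.coeff g •
      (PowerSeries.X ^ (n g - n g₀).toNat * (p g : PowerSeries (MonoidAlgebra ℚ G))) = 0 := by
    apply ofPowerSeries_injective (Γ := ℤ)
    rw [map_zero, map_sum, ← mul_zero (single (-n g₀) (1 : MonoidAlgebra ℚ G)), ← hf,
      MonoidAlgebra.lift_apply, Finsupp.sum, Finset.mul_sum]
    refine Finset.sum_congr rfl fun g hg => ?_
    rw [hφ g, mul_smul_comm, ← mul_assoc, single_mul_single, one_mul]
    have e : -n g₀ + n g = ((n g - n g₀).toNat : ℤ) := by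
      have := hmin g hg
      omega
    rw [e, ← ofPowerSeries_X_pow, ← map_mul]
    exact map_rat_smul (ofPowerSeries ℤ (MonoidAlgebra ℚ G)) _ _
  have h0 := congrArg (fun q => (PowerSeries.constantCoeff q).coeff g₀) hsum
  simp only [map_sum, map_zero] at h0
  rw [MonoidAlgebra.coeff_sum, Finset.sum_apply', Finset.sum_eq_single g₀] at h0
  · simp only [sub_self, Int.toNat_zero, pow_zero, one_mul, PowerSeries.constantCoeff_smul, hp] at h0
    simp at h0
    exact (Finsupp.mem_support_iff.mp hg₀) h0
  · intro g hg hne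
    simp only [PowerSeries.constantCoeff_smul, map_mul, map_pow, PowerSeries.constantCoeff_X, hp]
    rcases Nat.eq_zero_or_pos (n g - n g₀).toNat with h | h
    · simp [h, hne]
    · simp [h.ne']
  · exact fun h => absurd hg₀ h

end Lead

/-! ### The group algebra of the triangle group embeds -/

theorem exists_succ_eq_mul {G : Type*} [Group G] (d : ℤ → G) :
    ∃ n : ℤ → G, ∀ i, n (i + 1) = n i * d i := by
  refine ⟨fun i => Int.inductionOn' (motive := fun _ => G) i 0 1 (fun k _ x => x * d k)
    (fun k _ x => x * (d (k - 1))⁻¹), fun i => ?_⟩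
  rcases le_or_gt 0 i with h | h
  · exact Int.inductionOn'_add_one h
  · have := Int.inductionOn'_sub_one (motive := fun _ => G) (b := 0) (z := i + 1) (zero := 1)
      (succ := fun k _ x => x * d k) (pred := fun k _ x => x * (d (k - 1))⁻¹) (by omega)
    simp only [add_sub_cancel_right] at this
    beta_reduce
    rw [this, inv_mul_cancel_right]

/-- Ratios of consecutive values along the zigzag can be prescribed freely. This supplies the
weights of the Laurent representation. -/
theorem exists_alternating {G : Type*} [Group G] (d e : ℤ → G) :
    ∃ n : Pt → G, (∀ i, n (.lower i) = n (.upper i) * d i) ∧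
      ∀ i, n (.upper (i + 1)) = n (.lower i) * e i := by
  obtain ⟨n, hn⟩ := exists_succ_eq_mul fun i => d i * e i
  refine ⟨fun | .upper i => n i | .lower i => n i * d i, fun i => rfl, fun i => ?_⟩
  show n (i + 1) = n i * d i * e i
  rw [hn, mul_assoc]

/-- The position of a marked point in the zigzag. -/
def Pt.index : Pt → ℤ
  | .upper i => 2 * i
  | .lower i => 2 * i + 1

/-- The sign of a marked point on the line: upper points are negative, lower ones positive. -/
def Pt.sign : Pt → ℤ
  | .upper _ => -1
  | .lower _ => 1

/-- The signs of the points are chosen so that `sgn a b • (z_b - z_a)` has its leading term with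
coefficient `+1`, whichever endpoint comes later. -/
theorem sgn_mul_sign_tgt {a b : Pt} (h : a.index < b.index) : sgn a b * b.sign = 1 := by
  rcases a with i | i <;> rcases b with j | j <;> simp only [Pt.index] at h <;>
    simp only [sgn, Pt.sign] <;> (try split_ifs) <;> omega

theorem sgn_mul_sign_src {a b : Pt} (h : b.index < a.index) : sgn a b * a.sign = -1 := by
  rcases a with i | i <;> rcases b with j | j <;> simp only [Pt.index] at h <;>
    simp only [sgn, Pt.sign] <;> (try split_ifs) <;> omega

theorem index_injective : Function.Injective Pt.index := by
  rintro (i | i) (j | j) h <;> simp only [Pt.index] at h <;> (try congr 1) <;> omega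

/-- A group element as a unit of the group algebra. -/
noncomputable def elUnit : T →* QTˣ := (MonoidAlgebra.of ℚ T).toHomUnits

theorem elUnit_val (g : T) : (elUnit g : QT) = el g := rfl

/-- A monomial as a unit of the ring of Laurent series. -/
noncomputable def constUnit : T →* (HahnSeries ℤ QT)ˣ :=
  (Units.map (HahnSeries.C (Γ := ℤ) (R := QT)).toMonoidHom).comp elUnit

theorem hasLead_constUnit (g : T) : HasLead (constUnit g : HahnSeries ℤ QT) (elUnit g) :=
  hasLead_C _

theorem single_zsmul (k c : ℤ) (x : QT) :
    HahnSeries.single k (c • x) = c • HahnSeries.single k x :=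
  map_zsmul (HahnSeries.single.addMonoidHom k) c x

section Coordinates
variable (z : Pt → T)

/-- The coordinate of a marked point on the line over the ring of Laurent series. -/
noncomputable def coord (a : Pt) : HahnSeries ℤ QT :=
  HahnSeries.single (-a.index) (a.sign • el (z a))

theorem hasLead_coord_tgt {a b : Pt} (h : a.index < b.index) :
    HasLead (sgn a b • (coord z b - coord z a)) (elUnit (z b)) := by
  have := hasLead_sub h (elUnit (z b)) ((sgn a b * a.sign) • el (z a))
  rwa [elUnit_val, ← one_zsmul (el (z b)), ← sgn_mul_sign_tgt h, mul_smul, mul_smul,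
    single_zsmul _ (sgn a b), single_zsmul _ (sgn a b), ← smul_sub] at this

theorem hasLead_coord_src {a b : Pt} (h : b.index < a.index) :
    HasLead (sgn a b • (coord z b - coord z a)) (elUnit (z a)) := by
  have := hasLead_sub h (elUnit (z a)) ((-sgn a b * b.sign) • el (z b))
  have e : -sgn a b * a.sign = 1 := by rw [neg_mul, sgn_mul_sign_src h, neg_neg]
  rwa [elUnit_val, ← one_zsmul (el (z a)), ← e, mul_smul, mul_smul,
    single_zsmul _ (-sgn a b), single_zsmul _ (-sgn a b), ← smul_sub, neg_smul, ← smul_neg,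
    neg_sub] at this

theorem isUnit_coord_sub {a b : Pt} (h : a ≠ b) : IsUnit (coord z b - coord z a) := by
  have : IsUnit (sgn a b • (coord z b - coord z a)) := by
    rcases lt_or_gt_of_ne (index_injective.ne h) with h | h
    · exact (hasLead_coord_tgt z h).isUnit
    · exact (hasLead_coord_src z h).isUnit
  rcases Int.isUnit_iff.mp (IsUnit.of_mul_eq_one _ (sgn_mul_self a b)) with e | e
  · rwa [e, one_smul] at this
  · rw [e, neg_smul, one_smul] at this
    exact (IsUnit.neg_iff _).mp this

end Coordinates

/-- A representation of the algebra of the strip by Laurent series in which the leading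
coefficients of the edges of the triangulation are the generators of the triangle group. -/
theorem exists_laurent_realization : ∃ Φ : StripAlg →ₐ[ℚ] HahnSeries ℤ QT,
    ∀ γ : TriArc, HasLead (Φ γ.unit) (elUnit (t γ)) := by
  -- With `z a = n a * (m a)⁻¹`, an arc forward along the zigzag has leading coefficient `l a * n
  -- b`, a backward one `l a * n a * (m a)⁻¹ * m b`. Forward interior arcs determine `l` from `n`,
  -- forward boundary arcs then fix the ratios of `n`, and backward interior arcs the ratios of `m`.
  obtain ⟨n, hnl, hnu⟩ := exists_alternating (fun i => (t (.y (i - 1)))⁻¹ * t (.dLower (i - 1)))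
    (fun i => (t (.x' i))⁻¹ * t (.dUpper i))
  obtain ⟨l, hll, hlu⟩ : ∃ l : Pt → T, (∀ i, l (.lower i) = t (.y i) * (n (.upper (i + 1)))⁻¹) ∧
      ∀ i, l (.upper i) = t (.x' i) * (n (.lower i))⁻¹ :=
    ⟨fun | .lower i => t (.y i) * (n (.upper (i + 1)))⁻¹ | .upper i => t (.x' i) * (n (.lower i))⁻¹,
      fun _ => rfl, fun _ => rfl⟩
  obtain ⟨m, hml, hmu⟩ := exists_alternating
    (fun i => (t (.x i))⁻¹ * (l (.lower i) * n (.lower i)))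
    (fun i => (t (.y' i))⁻¹ * (l (.upper (i + 1)) * n (.upper (i + 1))))
  let z : Pt → T := fun a => n a * (m a)⁻¹
  obtain ⟨Φ, hΦ⟩ := exists_realization (coord z) (fun a => constUnit (l a))
    (fun a => constUnit (m a)) (fun a b h => isUnit_coord_sub z h)
  refine ⟨Φ, ?_⟩
  have key_tgt : ∀ {a b : Pt} (h : a ≠ b) {g : T}, a.index < b.index → l a * n b = g →
      HasLead (Φ (edgeUnit a b h)) (elUnit g) := by
    rintro a b h g hab rfl
    have := ((hasLead_constUnit (l a)).mul (hasLead_coord_tgt z hab)).mul (hasLead_constUnit (m b))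
    rwa [← map_mul, ← map_mul, mul_assoc (l a), inv_mul_cancel_right, mul_smul_comm, smul_mul_assoc,
      ← hΦ a b h] at this
  have key_src : ∀ {a b : Pt} (h : a ≠ b) {g : T}, b.index < a.index →
      l a * n a * (m a)⁻¹ * m b = g → HasLead (Φ (edgeUnit a b h)) (elUnit g) := by
    rintro a b h g hab rfl
    have := ((hasLead_constUnit (l a)).mul (hasLead_coord_src z hab)).mul (hasLead_constUnit (m b))
    rwa [← map_mul, ← map_mul, ← mul_assoc (l a), mul_smul_comm, smul_mul_assoc,
      ← hΦ a b h] at this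
  have hnl' : ∀ i, n (.lower (i + 1)) = n (.upper (i + 1)) * ((t (.y i))⁻¹ * t (.dLower i)) :=
    fun i => by rw [hnl, add_sub_cancel_right]
  -- No freedom is left for the backward boundary arcs; their leading coefficients are right because
  -- of the triangle relations.
  have hu : ∀ i, t (.y' i) * (t (.x' i))⁻¹ * t (.dUpper i) * (t (.y i))⁻¹ * t (.x i) =
      t (.dUpper' i) := by
    intro i
    have : (t (.dUpper' i))⁻¹ =
        (t (.x i))⁻¹ * (t (.y i) * (t (.dUpper i))⁻¹ * t (.x' i)) * (t (.y' i))⁻¹ := by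
      rw [← t_upperRel]; group
    rw [← inv_inj, this]; group
  have hl : ∀ i, t (.x (i + 1)) * (t (.y i))⁻¹ * t (.dLower i) * (t (.x' (i + 1)))⁻¹ * t (.y' i) =
      t (.dLower' i) := by
    intro i
    have : (t (.dLower' i))⁻¹ = (t (.y' i))⁻¹ *
        (t (.x' (i + 1)) * (t (.dLower i))⁻¹ * t (.y i)) * (t (.x (i + 1)))⁻¹ := by
      rw [← t_lowerRel]; group
    rw [← inv_inj, this]; group
  rintro (i | i | i | i | i | i | i | i)
  · refine key_tgt _ (by simp only [Pt.index]; omega) ?_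
    rw [hll, hnl']; group
  · refine key_src _ (by simp only [Pt.index]; omega) ?_
    rw [hml (i + 1), hmu, hlu, hnl', hll, ← hl]; group
  · refine key_tgt _ (by simp only [Pt.index]; omega) ?_
    rw [hlu, hnu]; group
  · refine key_src _ (by simp only [Pt.index]; omega) ?_
    rw [hmu, hml, hlu, hll, hnu, ← hu]; group
  · refine key_src _ (by simp only [Pt.index]; omega) ?_
    rw [hml]; group
  · refine key_tgt _ (by simp only [Pt.index]; omega) ?_
    rw [hlu]; group
  · refine key_tgt _ (by simp only [Pt.index]; omega) ?_
    rw [hll]; group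
  · refine key_src _ (by simp only [Pt.index]; omega) ?_
    rw [hmu]; group

theorem toStrip_injective : Function.Injective toStrip := by
  obtain ⟨Φ, hΦ⟩ := exists_laurent_realization
  let φ : T →* (HahnSeries ℤ QT)ˣ := (Units.map (Φ : StripAlg →* HahnSeries ℤ QT)).comp toUnits
  have h : ∀ g, HasLead (φ g : HahnSeries ℤ QT) (elUnit g) := by
    -- Leading coefficients are multiplicative, so it suffices to check generators.
    let K : Subgroup T :=
      { carrier := {g | HasLead (φ g : HahnSeries ℤ QT) (elUnit g)}
        one_mem' := by
          rw [Set.mem_ofPred_eq, map_one, map_one]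
          simpa using hasLead_C (R := QT) 1
        mul_mem' := fun {g g'} hg hg' => by
          rw [Set.mem_ofPred_eq, map_mul, map_mul]
          exact hg.mul hg'
        inv_mem' := fun {g} hg => by
          rw [Set.mem_ofPred_eq, map_inv, map_inv]
          exact hg.inv }
    refine fun g => PresentedGroup.generated_by _ K (fun γ => ?_) g
    have := hΦ γ
    rwa [← toUnits_t] at this
  have hinj := lift_injective_of_hasLead ((Units.coeHom _).comp φ) h
  refine Function.Injective.of_comp (f := Φ) ?_
  have e : Φ.comp toStrip = MonoidAlgebra.lift ℚ (HahnSeries ℤ QT) T ((Units.coeHom _).comp φ) :=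
    MonoidAlgebra.algHom_ext (fun g => by simp [toStrip, φ]) (by ext)
  rw [← e] at hinj
  exact hinj

/-! ### The recursion -/

theorem isUnit_edge (a b : Pt) (h : a ≠ b) : IsUnit (edge a b h) := (edgeUnit a b h).isUnit

theorem toStrip_A (i : ℤ) :
    toStrip (el (A i)) = edgeInv (.upper (i + 1)) (.upper i) (upper_ne_succ i).symm := by
  rw [toStrip_el, A, map_inv, toUnits_t]; rfl

theorem toStrip_A' (i : ℤ) :
    toStrip (el (A' i)) = edgeInv (.upper i) (.upper (i + 1)) (upper_ne_succ i) := by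
  rw [toStrip_el, A', map_inv, toUnits_t]; rfl

theorem toStrip_B (i : ℤ) :
    toStrip (el (B i)) = edgeInv (.lower (i + 1)) (.lower i) (lower_ne_succ i).symm := by
  rw [toStrip_el, B, map_inv, toUnits_t]; rfl

theorem toStrip_B' (i : ℤ) :
    toStrip (el (B' i)) = edgeInv (.lower i) (.lower (i + 1)) (lower_ne_succ i) := by
  rw [toStrip_el, B', map_inv, toUnits_t]; rfl

theorem toStrip_A_inv (i : ℤ) :
    toStrip (el (A i)⁻¹) = edge (.upper (i + 1)) (.upper i) (upper_ne_succ i).symm := by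
  rw [toStrip_el, A, inv_inv, toUnits_t]; rfl

theorem toStrip_B_inv (i : ℤ) :
    toStrip (el (B i)⁻¹) = edge (.lower (i + 1)) (.lower i) (lower_ne_succ i).symm := by
  rw [toStrip_el, B, inv_inv, toUnits_t]; rfl

theorem isUnit_toStrip_el (g : T) : IsUnit (toStrip (el g)) := by
  rw [toStrip_el]; exact (toUnits g).isUnit

section Solution
variable {U V : ℤ → ℤ → QT}

theorem hasInitialData_of_edge
    (hU : ∀ i j : ℤ, toStrip (U i j) = edge (.lower i) (.upper j) (lower_ne_upper i j))
    (hV : ∀ i j : ℤ, toStrip (V i j) = edge (.upper i) (.lower j) (upper_ne_lower i j)) :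
    HasInitialData U V where
  U_diag i := toStrip_injective (by rw [hU, toStrip_el, toUnits_t]; rfl)
  V_diag i := toStrip_injective (by rw [hV, toStrip_el, toUnits_t]; rfl)
  U_succ i := toStrip_injective (by rw [hU, toStrip_el, toUnits_t]; rfl)

theorem isSolution_of_edge
    (hU : ∀ i j : ℤ, toStrip (U i j) = edge (.lower i) (.upper j) (lower_ne_upper i j))
    (hV : ∀ i j : ℤ, toStrip (V i j) = edge (.upper i) (.lower j) (upper_ne_lower i j)) :
    IsSolution U V where
  exchange_U i j := toStrip_injective <| by
    simp only [map_mul, map_add, hU, hV, toStrip_A, toStrip_A', toStrip_B_inv]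
    refine edge_exchange_side ?_ (lower_ne_succ i) (lower_ne_upper _ _) (lower_ne_upper _ _)
      (lower_ne_upper _ _) (lower_ne_upper _ _) (upper_ne_succ j).symm
    left
    simp [Cyclic, Increasing, Pt.Before]
  exchange_V i j := toStrip_injective <| by
    simp only [map_mul, map_add, hU, hV, toStrip_B, toStrip_B', toStrip_A_inv]
    refine edge_exchange_side ?_ (upper_ne_succ i) (upper_ne_lower _ _) (upper_ne_lower _ _)
      (upper_ne_lower _ _) (upper_ne_lower _ _) (lower_ne_succ j).symm
    -- The upper line runs from right to left, so this quadrilateral has the opposite orientation.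
    right
    simp [Cyclic, Increasing, Pt.Before]
  triangle_U i j := toStrip_injective <| by
    simp only [map_mul, hU, hV, toStrip_A, toStrip_A']
    exact edge_triangle ..
  triangle_V i j := toStrip_injective <| by
    simp only [map_mul, hU, hV, toStrip_B, toStrip_B']
    exact edge_triangle ..

/-- Cancellation in `QT` needs invertibility only in the larger algebra, where every `x_ab` is a
unit. -/
theorem mul_left_cancel_of_toStrip {x y y' : QT} (hx : IsUnit (toStrip x)) (h : x * y = x * y') :
    y = y' :=
  toStrip_injective (hx.mul_left_cancel (by rw [← map_mul, h, map_mul]))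

theorem mul_right_cancel_of_toStrip {x y y' : QT} (hx : IsUnit (toStrip x)) (h : y * x = y' * x) :
    y = y' :=
  toStrip_injective (hx.mul_right_cancel (by rw [← map_mul, h, map_mul]))

/-- The solution of the recursion is determined by its initial data. -/
theorem eq_of_isSolution
    (hU : ∀ i j : ℤ, toStrip (U i j) = edge (.lower i) (.upper j) (lower_ne_upper i j))
    (hV : ∀ i j : ℤ, toStrip (V i j) = edge (.upper i) (.lower j) (upper_ne_lower i j))
    {U' V' : ℤ → ℤ → QT} (h0' : HasInitialData U' V')
    (h' : IsSolution U' V') : U' = U ∧ V' = V := by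
  have h0 := hasInitialData_of_edge hU hV
  have h := isSolution_of_edge hU hV
  have uU : ∀ i j, IsUnit (toStrip (U i j)) := fun i j => by rw [hU]; exact isUnit_edge ..
  have uV : ∀ i j, IsUnit (toStrip (V i j)) := fun i j => by rw [hV]; exact isUnit_edge ..
  have uUA : ∀ i j g, IsUnit (toStrip (U i j * el g)) := fun i j g => by
    rw [map_mul]; exact (uU i j).mul (isUnit_toStrip_el g)
  have uAV : ∀ i j g, IsUnit (toStrip (el g * V i j)) := fun i j g => by
    rw [map_mul]; exact (isUnit_toStrip_el g).mul (uV i j)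
  -- agreement on all arcs whose upper end is `p` steps ahead of its lower end
  let Q : ℤ → Prop := fun p => ∀ i, U' i (i + p) = U i (i + p) ∧ V' (i + p) i = V (i + p) i
  -- The exchange equation contains levels `p`, `p + 1` and, at level `p + 2`, only a `V`; the
  -- triangle equation then yields the `U` of that level. Downwards, the exchange equation gives `U`
  -- at level `p` and the triangle equation gives `V`.
  have up : ∀ p, Q p → Q (p + 1) → Q (p + 2) := by
    intro p q0 q1 i
    have a0 := (q0 (i + 1)).1
    have a1 := (q1 i)
    have a1' := (q1 (i + 1)).1
    have e := h.exchange_U i (i + 1 + p)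
    have e' := h'.exchange_U i (i + 1 + p)
    have t := h.triangle_U i (i + (p + 1))
    have t' := h'.triangle_U i (i + (p + 1))
    rw [show i + (p + 1) + 1 = i + (p + 2) by ring] at t t'
    rw [show i + 1 + p + 1 = i + (p + 2) by ring] at e e'
    rw [show i + 1 + (p + 1) = i + (p + 2) by ring] at a1'
    rw [show i + 1 + p = i + (p + 1) by ring] at e e' a0
    rw [a0, a1', a1.2, ← e] at e'
    have v := mul_left_cancel_of_toStrip (uUA _ _ _) e'
    rw [a1.1, v, a1.2, t] at t'
    exact ⟨(mul_right_cancel_of_toStrip (uAV _ _ _) (by simpa only [mul_assoc] using t')).symm, v⟩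
  have down : ∀ p, Q (p + 1) → Q (p + 2) → Q p := by
    intro p q1 q2
    have hUp : ∀ i, U' i (i + p) = U i (i + p) := by
      intro i
      have a1 := q1 (i - 1)
      have a1' := (q1 i).1
      have a2 := (q2 (i - 1)).2
      have e := h.exchange_U (i - 1) (i + p)
      have e' := h'.exchange_U (i - 1) (i + p)
      rw [show i - 1 + 1 = i by ring] at e e'
      rw [show i - 1 + (p + 1) = i + p by ring] at a1
      rw [show i - 1 + (p + 2) = i + p + 1 by ring] at a2
      rw [show i + (p + 1) = i + p + 1 by ring] at a1'
      rw [a1', a2, a1.2, ← e] at e'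
      exact mul_right_cancel_of_toStrip (uAV _ _ _) (by simpa only [mul_assoc] using e')
    intro i
    refine ⟨hUp i, ?_⟩
    have t := h.triangle_U i (i + p)
    have t' := h'.triangle_U i (i + p)
    have a1 := q1 i
    rw [show i + (p + 1) = i + p + 1 by ring] at a1
    rw [hUp, a1.1, a1.2, t] at t'
    exact (mul_left_cancel_of_toStrip (uUA _ _ _) t').symm
  have q0 : Q 0 := fun i => by
    simp only [add_zero]
    rw [h0.U_diag, h0'.U_diag, h0.V_diag, h0'.V_diag]
    exact ⟨rfl, rfl⟩
  have q1 : Q 1 := fun i => by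
    refine ⟨by rw [h0.U_succ, h0'.U_succ], ?_⟩
    -- `V_{i+1,i}` is not an initial value; the triangle equation recovers it.
    have t := h.triangle_U i i
    have t' := h'.triangle_U i i
    have a := q0 i
    simp only [add_zero] at a
    rw [a.1, a.2, h0'.U_succ, ← h0.U_succ, ← t] at t'
    exact mul_left_cancel_of_toStrip (uUA _ _ _) t'
  have hQ : ∀ p, Q p ∧ Q (p + 1) := by
    intro p
    induction p with
    | zero => exact ⟨q0, q1⟩
    | succ p ih => exact ⟨ih.2, by rw [add_assoc]; exact up _ ih.1 ih.2⟩
    | pred p ih =>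
      refine ⟨down _ ?_ ?_, ?_⟩
      · rw [sub_add_cancel]; exact ih.1
      · rw [show -(p : ℤ) - 1 + 2 = -p + 1 by ring]; exact ih.2
      · rw [sub_add_cancel]; exact ih.1
  refine ⟨?_, ?_⟩ <;> funext i j
  · have := ((hQ (j - i)).1 i).1
    rwa [add_sub_cancel] at this
  · have := ((hQ (i - j)).1 j).2
    rwa [add_sub_cancel] at this

end Solution

/-! ### Conserved quantities and the field of fractions -/

/-- A nonzero `1 × 1` matrix is full, since a factorization through size `0` is an empty sum. -/
theorem isUnit_toFrac {R : Type*} [Ring R] {r : R} (hr : r ≠ 0) : IsUnit (toFrac R r) := by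
  have hfull : IsFull (Matrix.of fun _ _ : Fin 1 => r) := by
    intro p P Q h
    by_contra! hp
    obtain rfl : p = 0 := by omega
    have := congrFun (congrFun h 0) 0
    simp [Matrix.mul_apply] at this
    exact hr this
  let M : FullMatrix R := ⟨1, _, hfull⟩
  have h1 := RingQuot.mkRingHom_rel (FracRel.mul_inv M 0 0)
  have h2 := RingQuot.mkRingHom_rel (FracRel.inv_mul M 0 0)
  simp only [Matrix.mul_apply, Matrix.one_apply_eq, map_one] at h1 h2
  rw [Fin.sum_univ_one, map_mul] at h1 h2
  exact ⟨⟨_, _, h1, h2⟩, rfl⟩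

theorem ne_zero_of_isUnit_toStrip {u : QT} (h : IsUnit (toStrip u)) : u ≠ 0 := by
  have : Nontrivial StripAlg := toStrip_injective.nontrivial
  rintro rfl
  exact h.ne_zero (map_zero _)

/-- The angle is a sum of group elements, hence integral: `x_cd` is such a sum and both outer
factors lie in `T`. -/
theorem exists_angle (a c d : Pt) (hac : a ≠ c) (had : a ≠ d) (hcd : c ≠ d)
    (hc : ∃ g, toStrip (el g) = edgeInv c a hac.symm) (hd : ∃ g, toStrip (el g) = edgeInv a d had) :
    ∃ H : QT, H ∈ ZT ∧
      toStrip H = edgeInv c a hac.symm * edge c d hcd * edgeInv a d had := by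
  obtain ⟨g, hg⟩ := hc
  obtain ⟨k, hk⟩ := hd
  obtain ⟨u, hu, hu'⟩ := isPositive_edge c d hcd
  exact ⟨el g * u * el k, (((isSumOfElements_el g).mul hu).mul (isSumOfElements_el k)).mem_ZT,
    by rw [map_mul, map_mul, hg, hu', hk]⟩

theorem exists_HPlus {U : ℤ → ℤ → QT}
    (hU : ∀ i j : ℤ, toStrip (U i j) = edge (.lower i) (.upper j) (lower_ne_upper i j)) (i : ℤ) :
    ∃ H : QT, H ∈ ZT ∧
      ∀ j, U j i * H = U j (i - 1) * el (A (i - 1)) + U j (i + 1) * el (A' i) := by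
  have h1 := (upper_ne_succ (i - 1)).symm
  have hA := toStrip_A (i - 1)
  have hc := toStrip_A' (i - 1)
  simp only [sub_add_cancel] at h1 hA hc
  have hcd : Pt.upper (i - 1) ≠ Pt.upper (i + 1) := by simp; omega
  obtain ⟨H, hH, hH'⟩ := exists_angle (.upper i) (.upper (i - 1)) (.upper (i + 1)) h1
    (upper_ne_succ i) hcd ⟨_, hc⟩ ⟨_, toStrip_A' i⟩
  refine ⟨H, hH, fun j => toStrip_injective ?_⟩
  simp only [map_mul, map_add, hU, hA, toStrip_A', hH']
  refine edge_mul_angle (b := .lower j) ?_ (upper_ne_lower i j) _ _ _ _ _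
  simp [Cyclic, Increasing, Pt.Before]

theorem exists_HMinus {V : ℤ → ℤ → QT}
    (hV : ∀ i j : ℤ, toStrip (V i j) = edge (.upper i) (.lower j) (upper_ne_lower i j)) (i : ℤ) :
    ∃ H : QT, H ∈ ZT ∧
      ∀ j, V j i * H = V j (i - 1) * el (B (i - 1)) + V j (i + 1) * el (B' i) := by
  have h1 := (lower_ne_succ (i - 1)).symm
  have hB := toStrip_B (i - 1)
  have hc := toStrip_B' (i - 1)
  simp only [sub_add_cancel] at h1 hB hc
  have hcd : Pt.lower (i - 1) ≠ Pt.lower (i + 1) := by simp; omega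
  obtain ⟨H, hH, hH'⟩ := exists_angle (.lower i) (.lower (i - 1)) (.lower (i + 1)) h1
    (lower_ne_succ i) hcd ⟨_, hc⟩ ⟨_, toStrip_B' i⟩
  refine ⟨H, hH, fun j => toStrip_injective ?_⟩
  simp only [map_mul, map_add, hV, hB, toStrip_B', hH']
  refine edge_mul_angle (b := .upper j) ?_ (lower_ne_upper i j) _ _ _ _ _
  simp [Cyclic, Increasing, Pt.Before]

theorem inverse_mul_eq {R : Type*} [Ring R] {x y z : R} (hx : IsUnit x) (h : x * y = z) :
    Ring.inverse x * z = y := by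
  rw [← h, ← mul_assoc, Ring.inverse_mul_cancel _ hx, one_mul]

end NCStrip

theorem theorem4 :
    -- the triangle group is free on `A_i, Ā_i, B_i, U_{i,i}, V_{i,i}, U_{i,i+1}`
    Function.Bijective (FreeGroup.lift NCStrip.FreeGen.val : FreeGroup NCStrip.FreeGen →* NCStrip.T) ∧
    -- its group algebra is a subalgebra of the algebra of the strip
    Function.Injective NCStrip.toStrip ∧
    -- the elements `U_{ij} = x_{i₋,j₊}`, `V_{ij} = x_{i₊,j₋}` lie in the group algebra
    ∃ U V : ℤ → ℤ → NCStrip.QT,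
      (∀ i j : ℤ, NCStrip.toStrip (U i j) =
        NCStrip.edge (.lower i) (.upper j) (NCStrip.lower_ne_upper i j)) ∧
      (∀ i j : ℤ, NCStrip.toStrip (V i j) =
        NCStrip.edge (.upper i) (.lower j) (NCStrip.upper_ne_lower i j)) ∧
      -- they are sums of group elements, in particular they are integral
      (∀ i j : ℤ, NCStrip.IsSumOfElements (U i j) ∧ NCStrip.IsSumOfElements (V i j)) ∧
      (∀ i j : ℤ, U i j ∈ NCStrip.ZT ∧ V i j ∈ NCStrip.ZT) ∧
      -- they are the unique solution of the recursion with the given initial data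
      NCStrip.HasInitialData U V ∧ NCStrip.IsSolution U V ∧
      (∀ U' V' : ℤ → ℤ → NCStrip.QT, NCStrip.HasInitialData U' V' → NCStrip.IsSolution U' V' →
        U' = U ∧ V' = V) ∧
      -- the elements `H^±_{ij}` are well defined in `Frac`, do not depend on `j`, and are integral
      (∀ i j : ℤ, IsUnit (NCStrip.toFrac NCStrip.QT (U i j)) ∧
        IsUnit (NCStrip.toFrac NCStrip.QT (V i j))) ∧
      ∃ Hp Hm : ℤ → NCStrip.QT,
        (∀ i : ℤ, Hp i ∈ NCStrip.ZT ∧ Hm i ∈ NCStrip.ZT) ∧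
        (∀ i j : ℤ, NCStrip.HPlus U i j = NCStrip.toFrac NCStrip.QT (Hp i)) ∧
        (∀ i j : ℤ, NCStrip.HMinus V i j = NCStrip.toFrac NCStrip.QT (Hm i)) ∧
        -- the same identities before localization
        (∀ i j : ℤ, U j i * Hp i =
          U j (i - 1) * NCStrip.el (NCStrip.A (i - 1)) + U j (i + 1) * NCStrip.el (NCStrip.A' i)) ∧
        (∀ i j : ℤ, V j i * Hm i =
          V j (i - 1) * NCStrip.el (NCStrip.B (i - 1)) + V j (i + 1) * NCStrip.el (NCStrip.B' i)) := by
  have hpos := NCStrip.isPositive_edge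
  choose U hUs hU using fun i j : ℤ => hpos (.lower i) (.upper j) (NCStrip.lower_ne_upper i j)
  choose V hVs hV using fun i j : ℤ => hpos (.upper i) (.lower j) (NCStrip.upper_ne_lower i j)
  have uU : ∀ i j, IsUnit (NCStrip.toFrac NCStrip.QT (U i j)) := fun i j =>
    NCStrip.isUnit_toFrac (NCStrip.ne_zero_of_isUnit_toStrip (hU i j ▸ NCStrip.isUnit_edge ..))
  have uV : ∀ i j, IsUnit (NCStrip.toFrac NCStrip.QT (V i j)) := fun i j =>
    NCStrip.isUnit_toFrac (NCStrip.ne_zero_of_isUnit_toStrip (hV i j ▸ NCStrip.isUnit_edge ..))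
  choose Hp hpZ hp using NCStrip.exists_HPlus hU
  choose Hm hmZ hm using NCStrip.exists_HMinus hV
  exact ⟨NCStrip.lift_val_bijective, NCStrip.toStrip_injective, U, V, hU, hV,
    fun i j => ⟨hUs i j, hVs i j⟩, fun i j => ⟨(hUs i j).mem_ZT, (hVs i j).mem_ZT⟩,
    NCStrip.hasInitialData_of_edge hU hV, NCStrip.isSolution_of_edge hU hV,
    fun U' V' h0 h => NCStrip.eq_of_isSolution hU hV h0 h, fun i j => ⟨uU i j, uV i j⟩,
    Hp, Hm, fun i => ⟨hpZ i, hmZ i⟩,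
    fun i j => NCStrip.inverse_mul_eq (uU j i) (by rw [← map_mul, hp]),
    fun i j => NCStrip.inverse_mul_eq (uV j i) (by rw [← map_mul, hm]),
    fun i j => hp i j, fun i j => hm i j⟩
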